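/- Let $\lambda,K>0$ and $\delta\in(0,1)$. There are thresholds and constants, named below, which depend only on $\lambda,K,\delta$ and on the parameters in their brackets, such that the following holds for every probability space, every filtration $(\mathcal F_n)_{n\ge 0}$ and every real martingale $X=(X_n)_{n\ge 0}$ with $X_0=0$ a.s. whose increments $\Delta X_k=X_k-X_{k-1}$ satisfy $\mathbb E[e^{\lambda|\Delta X_k|}]<K$ for all $k\ge 1$. First, $X_n/n\to 0$ almost surely. Moreover: (a) For $\varepsilon>0$ and $n_0\ge 1$ let $\mathcal O_{\varepsilon,n_0}=\sum_{n\ge n_0}\mathbf 1\{|X_n/n|>\varepsilon\}$ and $\beta=\tfrac{1-\delta}{2}\lambda^{2/3}\varepsilon^{2/3}$. For every $0<p<\beta$, $$\mathbb E\big[e^{p\,\mathcal O_{\varepsilon,n_0}^{1/3}}\big]\le C(\varepsilon,n_0,p)<\infty ,$$ and if $n_0\ge N(\varepsilon)$, then for every $0<p<\beta$ $$\mathbb E\big[e^{p\,\mathcal O_{\varepsilon,n_0}^{1/3}}\big]\le 1+\sum_{n=n_0}^\infty n^{2/3}e^{-(\beta-p)n^{1/3}}<\infty .$$ There are constants $d=d(\varepsilon,n_0)>0$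 and $D=D(\varepsilon,n_0)>0$ such that for all $0<p<\beta$ and all integers $k\ge 2$ $$\mathbb P(\mathcal O_{\varepsilon,n_0}\ge k)\le \big(d+D(k-1)^{2-\frac13}\big)e^{-p(k-1)^{1/3}} .$$ (b) With the Ky Fan distance $\mathrm d_{\mathrm{KF}}(Y,Z)=\inf\{\eta>0:\mathbb P(|Y-Z|>\eta)\le\eta\}$ and the principal branch $W$ of Lambert's function ($W(x)e^{W(x)}=x$), there is $N'$ such that for all $n\ge \max(N',1)$ $$\mathrm d_{\mathrm{KF}}\Big(\frac{X_n}{n},0\Big)\le 3\sqrt3\;\frac{\Big(W\big(\tfrac{1-\delta}{3}\lambda^{2/3}n^{1/3}\big)\Big)^{3/2}}{(1-\delta)^{3/2}\,\lambda\, n^{1/2}} .$$ (c) For every $\theta>0$ and $\varepsilon_n=\dfrac{\ln^3(n+1)}{\sqrt n}\,\dfrac{2(1+\theta)}{(1-\delta)\lambda^{2/3}}$, $$\limsup_{n\to\infty}\Big|\frac{X_n}{n}\Big|\,\varepsilon_n^{-1}\le 1\quad\text{a.s.},$$ and there is $N''(\theta)$ such that for all $n_0\ge \max(N''(\theta),1)$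 the overlap $\mathcal O_{\epsilon,n_0}=\sum_{n\ge n_0}\mathbf 1\{|X_n/n|>\varepsilon_n\}$ satisfies $$\mathbb E[\mathcal O_{\epsilon,n_0}]\le\sum_{n=n_0}^\infty\frac1{n\ln^{1+\theta}(n+1)} .$$ -/

import Mathlib

open MeasureTheory ProbabilityTheory Filter Topology
open scoped ENNReal

noncomputable section

/-- `X` is a martingale started in `0` (indexed by `0, 1, 2, …`) whose increments satisfy
`E[exp (lam * |X k - X (k - 1)|)] < K` for all `k ≥ 1`. -/
structure IsExpMartingale {Ω : Type*} {m : MeasurableSpace Ω} (μ : Measure Ω)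
    (ℱ : Filtration ℕ m) (X : ℕ → Ω → ℝ) (lam K : ℝ) : Prop where
  martingale : Martingale X ℱ μ
  zero : X 0 =ᵐ[μ] 0
  expMoment : ∀ k : ℕ, 1 ≤ k →
    ∫⁻ ω, ENNReal.ofReal (Real.exp (lam * |X k ω - X (k - 1) ω|)) ∂μ < ENNReal.ofReal K

/-- The overlap statistic `∑_{n ≥ n₀} 1{|Y n| > ε n}`, with values in `[0, ∞]`. -/
def overlap {Ω : Type*} (Y : ℕ → Ω → ℝ) (ε : ℕ → ℝ) (n₀ : ℕ) (ω : Ω) : ℝ≥0∞ :=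
  ∑' j : ℕ, Set.indicator {ω' | ε (n₀ + j) < |Y (n₀ + j) ω'|} (fun _ => (1 : ℝ≥0∞)) ω

/-- The Ky Fan distance `inf {ε > 0 | P(|X - Y| > ε) ≤ ε}` of two real random variables. -/
def kyFanDist {Ω : Type*} [MeasurableSpace Ω] (μ : Measure Ω) (X Y : Ω → ℝ) : ℝ :=
  sInf {ε : ℝ | 0 < ε ∧ μ {ω | ε < |X ω - Y ω|} ≤ ENNReal.ofReal ε}

/-- The principal branch of Lambert's `W` function: for `x ≥ -1/e` the unique `w ≥ -1` with
`w * exp w = x`. -/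
def lambertW (x : ℝ) : ℝ :=
  Function.invFunOn (fun w : ℝ => w * Real.exp w) (Set.Ici (-1)) x

/-- The rate `β = (1 - δ) / 2 * lam ^ (2/3) * ε ^ (2/3)`. -/
def weibullRate (lam δ ε : ℝ) : ℝ :=
  (1 - δ) / 2 * lam ^ (2 / 3 : ℝ) * ε ^ (2 / 3 : ℝ)

/-- The constant `∑_{n ≥ n₀} n ^ (2/3) * exp (-(β - p) * n ^ (1/3))`, with values in `[0, ∞]`. -/
def weibullConst (β p : ℝ) (n₀ : ℕ) : ℝ≥0∞ :=
  ∑' j : ℕ, ENNReal.ofReal (((n₀ + j : ℕ) : ℝ) ^ (2 / 3 : ℝ) *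
    Real.exp (-(β - p) * ((n₀ + j : ℕ) : ℝ) ^ (1 / 3 : ℝ)))

/-- The tolerance `ε n = ln³(n + 1) / √n * (2 (1 + θ) / ((1 - δ) lam ^ (2/3)))`. -/
def logTolerance (lam δ θ : ℝ) (n : ℕ) : ℝ :=
  Real.log (n + 1) ^ 3 / √(n : ℝ) * (2 * (1 + θ) / ((1 - δ) * lam ^ (2 / 3 : ℝ)))

end

/-! Everything rests on one deviation bound, `measure_deviation_le`. Put u = λ^(2/3) x^(2/3)
n^(1/3). Once u exceeds a constant depending only on K and δ, P(|X_n/n| > x) ≤ exp(-(1-δ)u/2). The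
condition involves n and x only through u, so x may vary with n.

For the bound, each increment is cut at a level c and both pieces are recentred by their conditional
means. The bounded piece obeys Azuma's inequality, with exponent close to n x²/(8c²). The remainders
are orthogonal with second moments at most K c² e^(-λc), so Chebyshev gives the exponent λc. The
choice c = u/(2λ) makes both exponents u/2 up to a loss in δ; this balance is the origin of the
power 1/3. The remaining prefactors are paid for by the factor 1-δ (`two_mul_exp_add_le_exp`).

For fixed x the bound is summable in n, and Borel–Cantelli gives the strong law. The overlap is at
most the index of the last deviation, which bounds exp(p O^(1/3)) by a series (`exp_overlap_le`);
and k deviations force one at offset k-1 or later, so a union bound gives the tail. The Ky Fan rate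
is the x at which the bound equals x itself, an equation solved by Lambert's W. For x = ε_n the
exponent is a multiple of log²(n+1), eventually above 2 log(n+1), so the bound falls below 1/n². -/

/-- A function measurable with respect to the past is orthogonal to a conditionally centred one. -/
theorem integral_mul_eq_zero_of_condExp_eq_zero {Ω : Type*} {m m₀ : MeasurableSpace Ω}
    {μ : Measure Ω} [IsProbabilityMeasure μ] (hm : m ≤ m₀) {f g : Ω → ℝ}
    (hf : StronglyMeasurable[m] f) (hfg : Integrable (f * g) μ) (hg : Integrable g μ)
    (h0 : μ[g | m] =ᵐ[μ] 0) : ∫ ω, f ω * g ω ∂μ = 0 := by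
  have h1 := condExp_mul_of_stronglyMeasurable_left hf hfg hg
  have h2 : ∫ ω, (μ[f * g | m]) ω ∂μ = ∫ ω, (f * g) ω ∂μ := integral_condExp hm
  have h3 : ∫ ω, (μ[f * g | m]) ω ∂μ = 0 := by
    rw [← integral_zero Ω ℝ (μ := μ)]
    refine integral_congr_ae ?_
    filter_upwards [h1, h0] with ω h1 h0
    simp [h1, h0]
  rw [h3] at h2
  exact h2.symm

theorem ae_abs_sum_range_le {Ω : Type*} {m : MeasurableSpace Ω} {μ : Measure Ω} {V : ℕ → Ω → ℝ}
    {b : ℝ} (hb : ∀ k, ∀ᵐ ω ∂μ, |V k ω| ≤ b) (n : ℕ) :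
    ∀ᵐ ω ∂μ, |∑ k ∈ Finset.range n, V k ω| ≤ n * b := by
  filter_upwards [ae_all_iff.2 hb] with ω h
  calc |∑ k ∈ Finset.range n, V k ω| ≤ ∑ k ∈ Finset.range n, |V k ω| :=
        Finset.abs_sum_le_sum_abs _ _
    _ ≤ ∑ _k ∈ Finset.range n, b := Finset.sum_le_sum fun k _ => h k
    _ = n * b := by simp

/-! ### Azuma and Chebyshev inequalities for increments `V k` from time k to time k + 1. -/

section Increments

variable {Ω : Type*} {m : MeasurableSpace Ω} {μ : Measure Ω} [IsProbabilityMeasure μ]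
  {ℱ : Filtration ℕ m} {V : ℕ → Ω → ℝ}

theorem stronglyMeasurable_sum_range (hV : ∀ k, StronglyMeasurable[ℱ (k + 1)] (V k)) (n : ℕ) :
    StronglyMeasurable[ℱ n] (fun ω => ∑ k ∈ Finset.range n, V k ω) := by
  refine Finset.stronglyMeasurable_fun_sum _ fun k hk => ?_
  exact (hV k).mono (ℱ.mono (Finset.mem_range.1 hk))

theorem integrable_exp_of_ae_abs_le {f : Ω → ℝ} (hf : AEStronglyMeasurable f μ) {b : ℝ}
    (hb : ∀ᵐ ω ∂μ, |f ω| ≤ b) (s : ℝ) : Integrable (fun ω => Real.exp (s * f ω)) μ := by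
  refine Integrable.of_bound (C := Real.exp (|s| * b))
    (Real.continuous_exp.comp_aestronglyMeasurable (hf.const_mul s)) ?_
  filter_upwards [hb] with ω h
  rw [Real.norm_eq_abs, Real.abs_exp]
  refine Real.exp_le_exp.2 ((le_abs_self _).trans ?_)
  rw [abs_mul]
  gcongr

/-- Exponential moments of sums of bounded martingale increments. -/
theorem integral_exp_sum_range_le (hV : ∀ k, StronglyMeasurable[ℱ (k + 1)] (V k)) {b : ℝ}
    (hb0 : 0 < b) (hb : ∀ k, ∀ᵐ ω ∂μ, |V k ω| ≤ b) (h0 : ∀ k, μ[V k | ℱ k] =ᵐ[μ] 0)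
    (s : ℝ) (n : ℕ) :
    ∫ ω, Real.exp (s * ∑ k ∈ Finset.range n, V k ω) ∂μ ≤ Real.exp (n * ((s * b) ^ 2 / 2)) := by
  have hVm : ∀ k, AEStronglyMeasurable (V k) μ := fun k =>
    ((hV k).mono (ℱ.le _)).aestronglyMeasurable
  have hint : ∀ n, Integrable (fun ω => Real.exp (s * ∑ k ∈ Finset.range n, V k ω)) μ := fun n =>
    integrable_exp_of_ae_abs_le
      ((stronglyMeasurable_sum_range hV n).mono (ℱ.le _)).aestronglyMeasurable
      (ae_abs_sum_range_le hb n) s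
  induction n with
  | zero => simp
  | succ n ih =>
    have hVi : Integrable (V n) μ := Integrable.of_bound (hVm n) b (hb n)
    have hprod : Integrable (fun ω => Real.exp (s * ∑ k ∈ Finset.range n, V k ω) * V n ω) μ :=
      (hint n).mul_bdd (c := b) (hVm n) (hb n)
    have horth : ∫ ω, Real.exp (s * ∑ k ∈ Finset.range n, V k ω) * V n ω ∂μ = 0 :=
      integral_mul_eq_zero_of_condExp_eq_zero (ℱ.le n)
        (Real.continuous_exp.comp_stronglyMeasurable
          ((stronglyMeasurable_sum_range hV n).const_mul s)) hprod hVi (h0 n)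
    -- By convexity the exponential lies below its chord over [-b, b]; the linear term of the chord
    -- integrates to zero by `horth`, leaving the factor cosh(s b).
    calc ∫ ω, Real.exp (s * ∑ k ∈ Finset.range (n + 1), V k ω) ∂μ
        ≤ ∫ ω, (Real.cosh (s * b) * Real.exp (s * ∑ k ∈ Finset.range n, V k ω) +
            Real.sinh (s * b) / b * (Real.exp (s * ∑ k ∈ Finset.range n, V k ω) * V n ω)) ∂μ := by
          refine integral_mono_ae (hint _) (((hint n).const_mul _).add (hprod.const_mul _)) ?_
          filter_upwards [hb n] with ω hω
          have h1 : |V n ω / b| ≤ 1 := by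
            rw [abs_div, abs_of_pos hb0]
            exact (div_le_one hb0).2 hω
          have h2 := Real.exp_mul_le_cosh_add_mul_sinh h1 (s * b)
          have h3 : V n ω / b * (s * b) = s * V n ω := by field_simp
          rw [h3] at h2
          rw [Finset.sum_range_succ, mul_add, Real.exp_add]
          calc _ ≤ Real.exp (s * ∑ k ∈ Finset.range n, V k ω) *
                (Real.cosh (s * b) + V n ω / b * Real.sinh (s * b)) := by gcongr
            _ = _ := by ring
      _ = Real.cosh (s * b) * ∫ ω, Real.exp (s * ∑ k ∈ Finset.range n, V k ω) ∂μ := by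
          rw [integral_add ((hint n).const_mul _) (hprod.const_mul _), integral_const_mul,
            integral_const_mul, horth, mul_zero, add_zero]
      _ ≤ Real.exp ((s * b) ^ 2 / 2) * Real.exp (n * ((s * b) ^ 2 / 2)) := by
          gcongr
          exact Real.cosh_le_exp_half_sq _
      _ = Real.exp ((n + 1 : ℕ) * ((s * b) ^ 2 / 2)) := by
          rw [← Real.exp_add]; push_cast; ring_nf

/-- The one-sided Azuma inequality. -/
theorem measureReal_sum_range_ge_le (hV : ∀ k, StronglyMeasurable[ℱ (k + 1)] (V k)) {b : ℝ}
    (hb0 : 0 < b) (hb : ∀ k, ∀ᵐ ω ∂μ, |V k ω| ≤ b) (h0 : ∀ k, μ[V k | ℱ k] =ᵐ[μ] 0)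
    {n : ℕ} (hn : 1 ≤ n) {a : ℝ} (ha : 0 ≤ a) :
    μ.real {ω | a ≤ ∑ k ∈ Finset.range n, V k ω} ≤ Real.exp (-(a ^ 2 / (2 * n * b ^ 2))) := by
  have hn' : (0 : ℝ) < n := by exact_mod_cast hn
  -- The tilt s = a / (n b²) minimises -s a + n s² b² / 2.
  have hint : Integrable
      (fun ω => Real.exp (a / (n * b ^ 2) * ∑ k ∈ Finset.range n, V k ω)) μ :=
    integrable_exp_of_ae_abs_le
      ((stronglyMeasurable_sum_range hV n).mono (ℱ.le _)).aestronglyMeasurable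
      (ae_abs_sum_range_le hb n) _
  refine (measure_ge_le_exp_mul_mgf a (by positivity) hint).trans ?_
  calc _ ≤ Real.exp (-(a / (n * b ^ 2)) * a) *
        Real.exp (n * ((a / (n * b ^ 2) * b) ^ 2 / 2)) := by
        gcongr
        exact integral_exp_sum_range_le hV hb0 hb h0 _ n
    _ = _ := by
        rw [← Real.exp_add]
        congr 1
        field_simp
        ring

/-- The two-sided Azuma inequality. -/
theorem measureReal_abs_sum_range_ge_le (hV : ∀ k, StronglyMeasurable[ℱ (k + 1)] (V k)) {b : ℝ}
    (hb0 : 0 < b) (hb : ∀ k, ∀ᵐ ω ∂μ, |V k ω| ≤ b) (h0 : ∀ k, μ[V k | ℱ k] =ᵐ[μ] 0)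
    {n : ℕ} (hn : 1 ≤ n) {a : ℝ} (ha : 0 ≤ a) :
    μ.real {ω | a ≤ |∑ k ∈ Finset.range n, V k ω|} ≤
      2 * Real.exp (-(a ^ 2 / (2 * n * b ^ 2))) := by
  have h1 := measureReal_sum_range_ge_le hV hb0 hb h0 hn ha
  have h2 := measureReal_sum_range_ge_le (μ := μ) (ℱ := ℱ) (V := fun k => -V k)
    (fun k => (hV k).neg) hb0 (fun k => by simpa using hb k)
    (fun k => (condExp_neg _ _).trans (by
      filter_upwards [h0 k] with ω h
      simp [h])) hn ha
  calc μ.real {ω | a ≤ |∑ k ∈ Finset.range n, V k ω|}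
      ≤ μ.real ({ω | a ≤ ∑ k ∈ Finset.range n, V k ω} ∪
          {ω | a ≤ ∑ k ∈ Finset.range n, (-V k) ω}) := by
        refine measureReal_mono fun ω hω => ?_
        rcases le_abs.1 (show a ≤ |∑ k ∈ Finset.range n, V k ω| from hω) with h | h
        · exact Or.inl h
        · right
          simpa using h
    _ ≤ _ := (measureReal_union_le _ _).trans (by linarith)

/-- Orthogonality of square integrable martingale increments. -/
theorem integral_sq_sum_range (hV : ∀ k, StronglyMeasurable[ℱ (k + 1)] (V k))
    (hL : ∀ k, MemLp (V k) 2 μ) (h0 : ∀ k, μ[V k | ℱ k] =ᵐ[μ] 0) (n : ℕ) :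
    ∫ ω, (∑ k ∈ Finset.range n, V k ω) ^ 2 ∂μ = ∑ k ∈ Finset.range n, ∫ ω, V k ω ^ 2 ∂μ := by
  have hS : ∀ n, MemLp (fun ω => ∑ k ∈ Finset.range n, V k ω) 2 μ := fun n =>
    memLp_finsetSum _ fun k _ => hL k
  induction n with
  | zero => simp
  | succ n ih =>
    have hprod := (hS n).integrable_mul (hL n)
    have horth : ∫ ω, (∑ k ∈ Finset.range n, V k ω) * V n ω ∂μ = 0 :=
      integral_mul_eq_zero_of_condExp_eq_zero (ℱ.le n) (stronglyMeasurable_sum_range hV n) hprod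
        ((hL n).integrable (by norm_num)) (h0 n)
    have hprod' : Integrable (fun ω => 2 * ((∑ k ∈ Finset.range n, V k ω) * V n ω)) μ :=
      hprod.const_mul 2
    rw [Finset.sum_range_succ, ← ih]
    calc ∫ ω, (∑ k ∈ Finset.range (n + 1), V k ω) ^ 2 ∂μ
        = ∫ ω, ((∑ k ∈ Finset.range n, V k ω) ^ 2 +
            2 * ((∑ k ∈ Finset.range n, V k ω) * V n ω) + V n ω ^ 2) ∂μ := by
          congr 1 with ω
          rw [Finset.sum_range_succ]
          ring
      _ = _ := by
          have hadd : Integrable (fun ω => (∑ k ∈ Finset.range n, V k ω) ^ 2 +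
            2 * ((∑ k ∈ Finset.range n, V k ω) * V n ω)) μ := (hS n).integrable_sq.add hprod'
          rw [integral_add hadd (hL n).integrable_sq,
            integral_add (hS n).integrable_sq hprod', integral_const_mul, horth]
          ring

/-- Chebyshev's inequality for sums of square integrable martingale increments. -/
theorem measureReal_abs_sum_range_ge_le_of_sq (hV : ∀ k, StronglyMeasurable[ℱ (k + 1)] (V k))
    (hL : ∀ k, MemLp (V k) 2 μ) (h0 : ∀ k, μ[V k | ℱ k] =ᵐ[μ] 0) {v : ℝ}
    (hv : ∀ k, ∫ ω, V k ω ^ 2 ∂μ ≤ v) (n : ℕ) {a : ℝ} (ha : 0 < a) :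
    μ.real {ω | a ≤ |∑ k ∈ Finset.range n, V k ω|} ≤ n * v / a ^ 2 := by
  have hS : MemLp (fun ω => ∑ k ∈ Finset.range n, V k ω) 2 μ :=
    memLp_finsetSum _ fun k _ => hL k
  have h := mul_meas_ge_le_integral_of_nonneg (μ := μ)
    (f := fun ω => (∑ k ∈ Finset.range n, V k ω) ^ 2) (ae_of_all _ fun ω => sq_nonneg _)
    hS.integrable_sq (a ^ 2)
  rw [integral_sq_sum_range hV hL h0] at h
  have hset : {ω | a ≤ |∑ k ∈ Finset.range n, V k ω|} =
      {ω | a ^ 2 ≤ (∑ k ∈ Finset.range n, V k ω) ^ 2} := by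
    ext ω
    simp only [Set.mem_ofPred_eq]
    rw [sq_le_sq, abs_of_pos ha]
  rw [hset, le_div_iff₀ (by positivity), mul_comm]
  refine h.trans ((Finset.sum_le_sum fun k _ => hv k).trans (by simp))

end Increments

/-! ### Truncation of the increments. -/

/-- Centring by the conditional expectation does not increase the second moment. -/
theorem integral_sub_condExp_sq_le {Ω : Type*} {m m₀ : MeasurableSpace Ω} {μ : Measure Ω}
    [IsProbabilityMeasure μ] (hm : m ≤ m₀) {f : Ω → ℝ} (hf : MemLp f 2 μ) :
    ∫ ω, (f ω - (μ[f | m]) ω) ^ 2 ∂μ ≤ ∫ ω, f ω ^ 2 ∂μ := by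
  have h1 := integral_condVar_add_variance_condExp hm hf
  have h2 : ∫ ω, (Var[f; μ | m]) ω ∂μ = ∫ ω, (f ω - (μ[f | m]) ω) ^ 2 ∂μ := integral_condExp hm
  have h3 := variance_nonneg (μ[f | m]) μ
  have h4 := variance_le_expectation_sq (μ := μ) hf.1
  simp only [Pi.pow_apply] at h4
  linarith

theorem condExp_sub_condExp_eq_zero {Ω : Type*} {m m₀ : MeasurableSpace Ω} {μ : Measure Ω}
    [IsProbabilityMeasure μ] (hm : m ≤ m₀) {f : Ω → ℝ} (hf : Integrable f μ) :
    μ[f - μ[f | m] | m] =ᵐ[μ] 0 := by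
  refine (condExp_sub hf integrable_condExp m).trans ?_
  rw [condExp_of_stronglyMeasurable hm stronglyMeasurable_condExp integrable_condExp, sub_self]

/-- Exponential domination of the square beyond a truncation level. -/
theorem sq_le_sq_mul_exp {lam c y : ℝ} (hlam : 0 < lam) (hc : 2 / lam ≤ c) (hcy : c ≤ y) :
    y ^ 2 ≤ c ^ 2 * Real.exp (-lam * c) * Real.exp (lam * y) := by
  have hc0 : 0 < c := lt_of_lt_of_le (by positivity) hc
  have hlc : 2 ≤ lam * c := by
    rw [div_le_iff₀ hlam] at hc; linarith
  have hd : 1 + lam * (y - c) / 2 ≤ Real.exp (lam * (y - c) / 2) := by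
    linarith [Real.add_one_le_exp (lam * (y - c) / 2)]
  have h1 : y ≤ c * Real.exp (lam * (y - c) / 2) := by
    have h2 : c * (1 + lam * (y - c) / 2) ≤ c * Real.exp (lam * (y - c) / 2) := by gcongr
    -- Since lam * c ≥ 2, c (1 + lam (y - c) / 2) ≥ c + (y - c) = y.
    nlinarith [mul_nonneg (sub_nonneg.2 hlc) (sub_nonneg.2 hcy)]
  calc y ^ 2 ≤ (c * Real.exp (lam * (y - c) / 2)) ^ 2 := by gcongr; linarith
    _ = _ := by
      rw [mul_pow, ← Real.exp_nat_mul, mul_assoc, ← Real.exp_add]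
      push_cast
      ring_nf

theorem sq_le_mul_exp {lam y : ℝ} (hlam : 0 < lam) (hy : 0 ≤ y) :
    y ^ 2 ≤ (2 / lam) ^ 2 * Real.exp (lam * y) := by
  have h1 : y ≤ 2 / lam * Real.exp (lam * y / 2) := by
    have h2 : lam * y / 2 ≤ Real.exp (lam * y / 2) := by
      linarith [Real.add_one_le_exp (lam * y / 2)]
    calc y = 2 / lam * (lam * y / 2) := by field_simp
      _ ≤ _ := by gcongr
  calc y ^ 2 ≤ (2 / lam * Real.exp (lam * y / 2)) ^ 2 := by gcongr
    _ = _ := by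
      rw [mul_pow, ← Real.exp_nat_mul]
      push_cast
      ring_nf

section Martingale

variable {Ω : Type*} {m : MeasurableSpace Ω} {μ : Measure Ω}
  {ℱ : Filtration ℕ m} {X : ℕ → Ω → ℝ} {lam K : ℝ}

namespace IsExpMartingale

theorem integrable_exp (h : IsExpMartingale μ ℱ X lam K) (k : ℕ) :
    Integrable (fun ω => Real.exp (lam * |X (k + 1) ω - X k ω|)) μ := by
  have h1 := h.expMoment (k + 1) (by omega)
  rw [Nat.add_sub_cancel] at h1
  have hD := (h.martingale.integrable (k + 1)).1.sub (h.martingale.integrable k).1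
  refine ⟨Real.continuous_exp.comp_aestronglyMeasurable (hD.norm.const_mul lam), ?_⟩
  rw [hasFiniteIntegral_iff_ofReal (ae_of_all _ fun ω => (Real.exp_pos _).le)]
  exact h1.trans ENNReal.ofReal_lt_top

theorem integral_exp_le (h : IsExpMartingale μ ℱ X lam K) (hK : 0 < K) (k : ℕ) :
    ∫ ω, Real.exp (lam * |X (k + 1) ω - X k ω|) ∂μ ≤ K := by
  have h1 := h.expMoment (k + 1) (by omega)
  rw [Nat.add_sub_cancel, ← ofReal_integral_eq_lintegral_ofReal (h.integrable_exp k)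
    (ae_of_all _ fun ω => (Real.exp_pos _).le)] at h1
  exact ((ENNReal.ofReal_lt_ofReal_iff hK).1 h1).le

theorem memLp_increment (h : IsExpMartingale μ ℱ X lam K) (hlam : 0 < lam) (k : ℕ) :
    MemLp (fun ω => X (k + 1) ω - X k ω) 2 μ := by
  have hD : AEStronglyMeasurable (fun ω => X (k + 1) ω - X k ω) μ :=
    (h.martingale.integrable (k + 1)).1.sub (h.martingale.integrable k).1
  rw [memLp_two_iff_integrable_sq hD]
  refine ((h.integrable_exp k).const_mul ((2 / lam) ^ 2)).mono' (hD.pow 2) ?_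
  refine ae_of_all _ fun ω => ?_
  have := sq_le_mul_exp hlam (abs_nonneg (X (k + 1) ω - X k ω))
  rw [sq_abs] at this
  simpa using this

theorem condExp_increment (h : IsExpMartingale μ ℱ X lam K) (k : ℕ) :
    μ[fun ω => X (k + 1) ω - X k ω | ℱ k] =ᵐ[μ] 0 := by
  have h1 := condExp_sub (h.martingale.integrable (k + 1)) (h.martingale.integrable k) (ℱ k)
  have h2 := h.martingale.condExp_ae_eq (Nat.le_succ k)
  have h3 := h.martingale.condExp_ae_eq (le_refl k)
  filter_upwards [h1, h2, h3] with ω h1 h2 h3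
  have h4 : (μ[fun ω => X (k + 1) ω - X k ω | ℱ k]) ω =
      (μ[X (k + 1) | ℱ k] - μ[X k | ℱ k]) ω := h1
  rw [h4, Pi.sub_apply, h2, h3]
  simp

/-- Truncation at level `c`: the bounded part is controlled by the Azuma inequality, the
remainder by its variance. -/
theorem measureReal_le_of_truncation [IsProbabilityMeasure μ]
    (h : IsExpMartingale μ ℱ X lam K) (hlam : 0 < lam) (hK : 0 < K) {n : ℕ} (hn : 1 ≤ n) {x c t : ℝ} (hx : 0 < x) (hc : 2 / lam ≤ c)
    (ht0 : 0 < t) (ht1 : t < 1) :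
    μ.real {ω | x < |X n ω|} ≤ 2 * Real.exp (-((t * x) ^ 2 / (2 * n * (2 * c) ^ 2))) +
      n * (c ^ 2 * Real.exp (-lam * c) * K) / ((1 - t) * x) ^ 2 := by
  have hc0 : 0 < c := lt_of_lt_of_le (by positivity) hc
  set D : ℕ → Ω → ℝ := fun k ω => X (k + 1) ω - X k ω with hD
  have hDm : ∀ k, StronglyMeasurable[ℱ (k + 1)] (D k) := fun k =>
    (h.martingale.stronglyMeasurable (k + 1)).sub
      ((h.martingale.stronglyMeasurable k).mono (ℱ.mono (Nat.le_succ k)))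
  have hset : ∀ k, MeasurableSet[ℱ (k + 1)] {ω | c < |D k ω|} := fun k =>
    (hDm k).norm.measurable measurableSet_Ioi
  set R : ℕ → Ω → ℝ := fun k => {ω | c < |D k ω|}.indicator (D k) with hR
  set Y : ℕ → Ω → ℝ := fun k => D k - R k with hY
  have hRm : ∀ k, StronglyMeasurable[ℱ (k + 1)] (R k) := fun k => (hDm k).indicator (hset k)
  have hYm : ∀ k, StronglyMeasurable[ℱ (k + 1)] (Y k) := fun k => (hDm k).sub (hRm k)
  have hDL : ∀ k, MemLp (D k) 2 μ := h.memLp_increment hlam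
  have hRL : ∀ k, MemLp (R k) 2 μ := fun k => (hDL k).indicator (ℱ.le _ _ (hset k))
  have hYL : ∀ k, MemLp (Y k) 2 μ := fun k => (hDL k).sub (hRL k)
  have hYi : ∀ k, Integrable (Y k) μ := fun k => (hYL k).integrable (by norm_num)
  have hRi : ∀ k, Integrable (R k) μ := fun k => (hRL k).integrable (by norm_num)
  have hYb : ∀ k ω, |Y k ω| ≤ c := by
    intro k ω
    by_cases hω : c < |D k ω|
    · simp [hY, hR, hω, hc0.le]
    · have h0 : R k ω = 0 := by simp [hR, hω]
      have h1 : Y k ω = D k ω - R k ω := rfl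
      rw [h1, h0, sub_zero]
      exact not_lt.1 hω
  have hRsq : ∀ k, ∫ ω, R k ω ^ 2 ∂μ ≤ c ^ 2 * Real.exp (-lam * c) * K := by
    intro k
    calc ∫ ω, R k ω ^ 2 ∂μ
        ≤ ∫ ω, c ^ 2 * Real.exp (-lam * c) * Real.exp (lam * |D k ω|) ∂μ := by
          refine integral_mono (hRL k).integrable_sq ((h.integrable_exp k).const_mul _) fun ω => ?_
          by_cases hω : c < |D k ω|
          · simpa [hR, hω] using sq_le_sq_mul_exp hlam hc hω.le
          · have : R k ω = 0 := by simp [hR, hω]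
            have h0 : R k ω ^ 2 = 0 := by rw [this]; ring
            exact h0.le.trans (by positivity)
      _ = c ^ 2 * Real.exp (-lam * c) * ∫ ω, Real.exp (lam * |D k ω|) ∂μ :=
          integral_const_mul _ _
      _ ≤ _ := by
          gcongr
          exact h.integral_exp_le hK k
  set V : ℕ → Ω → ℝ := fun k => Y k - μ[Y k | ℱ k] with hV
  set U : ℕ → Ω → ℝ := fun k => R k - μ[R k | ℱ k] with hU
  have hVm : ∀ k, StronglyMeasurable[ℱ (k + 1)] (V k) := fun k =>
    (hYm k).sub (stronglyMeasurable_condExp.mono (ℱ.mono (Nat.le_succ k)))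
  have hUm : ∀ k, StronglyMeasurable[ℱ (k + 1)] (U k) := fun k =>
    (hRm k).sub (stronglyMeasurable_condExp.mono (ℱ.mono (Nat.le_succ k)))
  have hUL : ∀ k, MemLp (U k) 2 μ := fun k => (hRL k).sub ((hRL k).condExp (by norm_num))
  have hV0 : ∀ k, μ[V k | ℱ k] =ᵐ[μ] 0 := fun k => condExp_sub_condExp_eq_zero (ℱ.le k) (hYi k)
  have hU0 : ∀ k, μ[U k | ℱ k] =ᵐ[μ] 0 := fun k => condExp_sub_condExp_eq_zero (ℱ.le k) (hRi k)
  -- Recentring can double the bound; hence 2c in the Azuma exponent.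
  have hVb : ∀ k, ∀ᵐ ω ∂μ, |V k ω| ≤ 2 * c := by
    intro k
    filter_upwards [ae_bdd_abs_condExp_of_ae_bdd_abs (m := ℱ k) (ae_of_all μ (hYb k))] with ω hω
    calc |V k ω| ≤ |Y k ω| + |(μ[Y k | ℱ k]) ω| := abs_sub _ _
      _ ≤ 2 * c := by linarith [hYb k ω, show |(μ[Y k | ℱ k]) ω| ≤ c from hω]
  have hUsq : ∀ k, ∫ ω, U k ω ^ 2 ∂μ ≤ c ^ 2 * Real.exp (-lam * c) * K := fun k =>
    (integral_sub_condExp_sq_le (ℱ.le k) (hRL k)).trans (hRsq k)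
  -- The conditional means of `Y k` and `R k` cancel because those of the increments vanish, so
  -- recentring both pieces does not change the sum.
  have hDec : ∀ᵐ ω ∂μ, X n ω =
      ∑ k ∈ Finset.range n, V k ω + ∑ k ∈ Finset.range n, U k ω := by
    have hce : ∀ k, ∀ᵐ ω ∂μ, V k ω + U k ω = D k ω := by
      intro k
      filter_upwards [condExp_add (hYi k) (hRi k) (ℱ k), h.condExp_increment k] with ω h1 h2
      have h3 : Y k + R k = D k := by simp [hY]
      have h4 : Y k ω + R k ω = D k ω := congrFun h3 ω
      rw [h3] at h1
      have h5 : (μ[Y k | ℱ k]) ω + (μ[R k | ℱ k]) ω = 0 := by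
        rw [← Pi.add_apply, ← h1]
        exact h2
      simp only [hV, hU, Pi.sub_apply]
      linarith
    filter_upwards [ae_all_iff.2 hce, h.zero] with ω h1 h2
    rw [← Finset.sum_add_distrib, Finset.sum_congr rfl fun k _ => h1 k,
      Finset.sum_range_sub (fun k => X k ω) n, h2]
    simp
  -- The level x is shared as t x and (1 - t) x: exceeding x forces one of the two sums to reach its
  -- share.
  have hA := measureReal_abs_sum_range_ge_le hVm (by positivity) hVb hV0 hn
    (a := t * x) (by positivity)
  have hB := measureReal_abs_sum_range_ge_le_of_sq hUm hUL hU0 hUsq n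
    (a := (1 - t) * x) (mul_pos (by linarith) hx)
  refine le_trans ?_ ((measureReal_union_le _ _).trans (add_le_add hA hB))
  refine ENNReal.toReal_mono (measure_ne_top _ _) (measure_mono_ae ?_)
  filter_upwards [hDec] with ω hω hmem
  have hmem' : x < |X n ω| := hmem
  by_contra hcon
  have hcon' : ¬ (t * x ≤ |∑ k ∈ Finset.range n, V k ω| ∨
      (1 - t) * x ≤ |∑ k ∈ Finset.range n, U k ω|) := hcon
  push Not at hcon'
  have := abs_add_le (∑ k ∈ Finset.range n, V k ω) (∑ k ∈ Finset.range n, U k ω)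
  rw [hω] at hmem'
  linarith [hcon'.1, hcon'.2]

end IsExpMartingale

end Martingale

/-! ### The large deviation inequality. -/

/-- The polynomial losses are absorbed by the factor `1 - δ` in the rate. -/
theorem two_mul_exp_add_le_exp {K δ u : ℝ} (hK : 0 < K) (hδ0 : 0 < δ)
    (hu : 12 / δ + 8 * K / δ ^ 2 ≤ u) :
    2 * Real.exp (-((1 - δ / 4) ^ 2 * u / 2)) + 4 * K / (δ ^ 2 * u) * Real.exp (-(u / 2)) ≤
      Real.exp (-((1 - δ) / 2 * u)) := by
  have h1 : 12 / δ ≤ u := le_trans (by linarith [show 0 < 8 * K / δ ^ 2 by positivity]) hu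
  have h2 : 8 * K / δ ^ 2 ≤ u := le_trans (by linarith [show 0 < 12 / δ by positivity]) hu
  have hu0 : 0 < u := lt_of_lt_of_le (by positivity) h1
  rw [div_le_iff₀ hδ0] at h1
  have hA : Real.exp (-((1 - δ / 4) ^ 2 * u / 2)) ≤ 1 / 4 * Real.exp (-((1 - δ) / 2 * u)) := by
    -- The constant 12 gives δu/4 ≥ 3, hence a factor 1/4; with the prefactor 2 this is half of the
    -- target. The constant 8K/δ² makes the other term at most the other half.
    have h3 : 4 ≤ Real.exp (δ * u / 4) := by
      linarith [Real.add_one_le_exp (δ * u / 4)]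
    calc Real.exp (-((1 - δ / 4) ^ 2 * u / 2))
        ≤ Real.exp (-(δ * u / 4) + -((1 - δ) / 2 * u)) := by
          refine Real.exp_le_exp.2 ?_
          nlinarith [mul_pos (pow_pos hδ0 2) hu0]
      _ = (Real.exp (δ * u / 4))⁻¹ * Real.exp (-((1 - δ) / 2 * u)) := by
          rw [Real.exp_add, Real.exp_neg (δ * u / 4)]
      _ ≤ 1 / 4 * Real.exp (-((1 - δ) / 2 * u)) := by
          gcongr
          rw [one_div]
          exact inv_anti₀ (by norm_num) h3
  have hB : 4 * K / (δ ^ 2 * u) * Real.exp (-(u / 2)) ≤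
      1 / 2 * Real.exp (-((1 - δ) / 2 * u)) := by
    have h3 : 4 * K / (δ ^ 2 * u) ≤ 1 / 2 := by
      rw [div_le_iff₀ (by positivity)] at h2 ⊢
      linarith
    have h4 : -(u / 2) ≤ -((1 - δ) / 2 * u) := by nlinarith
    gcongr
  linarith

/-- Read as u³ = λ² x² n, this lets n x² be replaced by u³/λ², so that both exponents become
functions of u alone. -/
theorem rpow_two_thirds_mul_cube {lam x y : ℝ} (hlam : 0 ≤ lam) (hx : 0 ≤ x) (hy : 0 ≤ y) :
    (lam ^ (2 / 3 : ℝ) * x ^ (2 / 3 : ℝ) * y ^ (1 / 3 : ℝ)) ^ 3 = lam ^ 2 * x ^ 2 * y := by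
  have h1 : ∀ z : ℝ, 0 ≤ z → (z ^ (2 / 3 : ℝ)) ^ 3 = z ^ 2 := fun z hz => by
    rw [← Real.rpow_natCast, ← Real.rpow_mul hz, ← Real.rpow_natCast]
    norm_num
  have h2 : (y ^ (1 / 3 : ℝ)) ^ 3 = y := by
    rw [← Real.rpow_natCast, ← Real.rpow_mul hy]
    norm_num
  rw [mul_pow, mul_pow, h1 lam hlam, h1 x hx, h2]

namespace IsExpMartingale

variable {Ω : Type*} {m : MeasurableSpace Ω} {μ : Measure Ω} [IsProbabilityMeasure μ]
  {ℱ : Filtration ℕ m} {X : ℕ → Ω → ℝ} {lam K δ : ℝ}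

/-- The large deviation inequality for martingales with exponential moments of the increments,
uniformly in the tolerance. -/
theorem measure_deviation_le (h : IsExpMartingale μ ℱ X lam K) (hlam : 0 < lam) (hK : 0 < K)
    (hδ0 : 0 < δ) (hδ1 : δ < 1) {n : ℕ} (hn : 1 ≤ n) {x : ℝ} (hx : 0 < x)
    (hu : 12 / δ + 8 * K / δ ^ 2 ≤ lam ^ (2 / 3 : ℝ) * x ^ (2 / 3 : ℝ) * (n : ℝ) ^ (1 / 3 : ℝ)) :
    μ {ω | x < |X n ω / n|} ≤
      ENNReal.ofReal (Real.exp (-(weibullRate lam δ x * (n : ℝ) ^ (1 / 3 : ℝ)))) := by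
  have hn0 : (0 : ℝ) < n := by exact_mod_cast hn
  have hcube := rpow_two_thirds_mul_cube hlam.le hx.le hn0.le
  set u := lam ^ (2 / 3 : ℝ) * x ^ (2 / 3 : ℝ) * (n : ℝ) ^ (1 / 3 : ℝ) with hudef
  have hu4 : 4 ≤ u := by
    refine le_trans ?_ hu
    have h1 : 12 ≤ 12 / δ := by rw [le_div_iff₀ hδ0]; linarith
    linarith [show 0 < 8 * K / δ ^ 2 by positivity]
  have hu0 : 0 < u := by linarith
  have hrate : weibullRate lam δ x * (n : ℝ) ^ (1 / 3 : ℝ) = (1 - δ) / 2 * u := by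
    rw [weibullRate, hudef]; ring
  have hset : {ω | x < |X n ω / n|} = {ω | n * x < |X n ω|} := by
    ext ω
    simp only [Set.mem_ofPred_eq]
    rw [abs_div, abs_of_pos hn0, lt_div_iff₀ hn0, mul_comm]
  rw [hrate, hset, ← ENNReal.ofReal_toReal (measure_ne_top μ {ω | n * x < |X n ω|})]
  refine ENNReal.ofReal_le_ofReal (le_trans ?_ (two_mul_exp_add_le_exp hK hδ0 hu))
  -- With c = u/(2 lam) the Azuma exponent is t² u/2 and the Chebyshev exponent u/2. The share t = 1
  -- - δ/4 costs only a small multiple of δu, and u ≥ 4 is exactly 2/lam ≤ c.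
  refine (h.measureReal_le_of_truncation hlam hK hn (x := n * x) (c := u / (2 * lam))
    (t := 1 - δ / 4) (by positivity) ?_ (by linarith) (by linarith)).trans (le_of_eq ?_)
  · rw [div_le_div_iff₀ hlam (by positivity)]
    nlinarith
  · have hxx : x ^ 2 * n = u ^ 3 / lam ^ 2 := by
      rw [hcube]; field_simp
    have e1 : ((1 - δ / 4) * (n * x)) ^ 2 / (2 * n * (2 * (u / (2 * lam))) ^ 2) =
        (1 - δ / 4) ^ 2 * u / 2 := by
      calc _ = (1 - δ / 4) ^ 2 * (x ^ 2 * n) / (2 * (u / lam) ^ 2) := by field_simp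
        _ = _ := by rw [hxx]; field_simp
    have e2 : -lam * (u / (2 * lam)) = -(u / 2) := by field_simp
    have e3 : ∀ E : ℝ, n * ((u / (2 * lam)) ^ 2 * E * K) / ((1 - (1 - δ / 4)) * (n * x)) ^ 2 =
        4 * K / (δ ^ 2 * u) * E := by
      intro E
      have e4 : 1 - (1 - δ / 4) = δ / 4 := by ring
      rw [e4]
      calc _ = (u / (2 * lam)) ^ 2 * E * K * 16 / (δ ^ 2 * (x ^ 2 * n)) := by field_simp; norm_num
        _ = _ := by rw [hxx]; field_simp; ring
    rw [e1, e2, e3]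

end IsExpMartingale

/-! ### Summability of stretched exponentials. -/

theorem summable_rpow_mul_exp_neg {γ : ℝ} (hγ : 0 < γ) :
    Summable fun n : ℕ => (n : ℝ) ^ (2 / 3 : ℝ) * Real.exp (-γ * (n : ℝ) ^ (1 / 3 : ℝ)) := by
  have ht : Tendsto (fun n : ℕ => (n : ℝ) ^ (1 / 3 : ℝ)) atTop atTop :=
    (tendsto_rpow_atTop (by norm_num)).comp tendsto_natCast_atTop_atTop
  -- The power -8 of n^(1/3), times n^(2/3), leaves n^(-2).
  have ho := ((isLittleO_exp_neg_mul_rpow_atTop hγ (-8)).comp_tendsto ht).isBigO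
  have hs : Summable fun n : ℕ => (n : ℝ) ^ (-2 : ℝ) :=
    Real.summable_nat_rpow.2 (by norm_num)
  refine summable_of_isBigO_nat hs ?_
  refine ((Asymptotics.isBigO_refl (fun n : ℕ => (n : ℝ) ^ (2 / 3 : ℝ)) atTop).mul ho).congr'
    (by rfl) ?_
  filter_upwards [eventually_gt_atTop 0] with n hn
  have hn' : (0 : ℝ) < n := by exact_mod_cast hn
  simp only [Function.comp]
  rw [← Real.rpow_mul hn'.le, ← Real.rpow_add hn']
  norm_num

theorem summable_exp_neg_cbrt {γ : ℝ} (hγ : 0 < γ) :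
    Summable fun n : ℕ => Real.exp (-γ * (n : ℝ) ^ (1 / 3 : ℝ)) := by
  -- The index n = 0 is dropped because the weight n^(2/3) vanishes there and comparison fails.
  refine (summable_nat_add_iff 1).1 (Summable.of_nonneg_of_le (fun n => (Real.exp_pos _).le)
    (fun n => ?_) ((summable_nat_add_iff 1).2 (summable_rpow_mul_exp_neg hγ)))
  refine le_mul_of_one_le_left (Real.exp_pos _).le (Real.one_le_rpow ?_ (by norm_num))
  push_cast
  linarith [Nat.cast_nonneg (α := ℝ) n]

theorem weibullConst_lt_top {β p : ℝ} (hp : p < β) (n₀ : ℕ) : weibullConst β p n₀ < ∞ := by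
  have hs := (summable_nat_add_iff n₀).2 (summable_rpow_mul_exp_neg (sub_pos.2 hp))
  have hs' : Summable fun j : ℕ => ((n₀ + j : ℕ) : ℝ) ^ (2 / 3 : ℝ) *
      Real.exp (-(β - p) * ((n₀ + j : ℕ) : ℝ) ^ (1 / 3 : ℝ)) := by
    simpa only [add_comm n₀] using hs
  exact hs'.tsum_ofReal_lt_top

/-! ### The overlap statistic: pathwise bounds and expectations. -/

section Overlap

variable {Ω : Type*} {Y : ℕ → Ω → ℝ} {ε : ℕ → ℝ} {n₀ : ℕ} {ω : Ω}

theorem overlap_le_of_forall_le {k : ℕ} (h : ∀ j, k ≤ j → |Y (n₀ + j) ω| ≤ ε (n₀ + j)) :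
    overlap Y ε n₀ ω ≤ k := by
  rw [overlap, tsum_eq_sum (s := Finset.range k)]
  · refine (Finset.sum_le_sum (g := fun _ => (1 : ℝ≥0∞)) fun j _ => ?_).trans (by simp)
    exact Set.indicator_le_self' (fun _ _ => zero_le_one) ω
  · intro j hj
    have hj' : k ≤ j := by simpa using hj
    simp [h j hj']

/-- Only k deviations fit into the offsets below k, so one more must occur at offset k or later. -/
theorem setOf_le_overlap_subset (k : ℕ) :
    {ω | ((k + 1 : ℕ) : ℝ≥0∞) ≤ overlap Y ε n₀ ω} ⊆
      ⋃ j : ℕ, {ω | ε (n₀ + (k + j)) < |Y (n₀ + (k + j)) ω|} := by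
  intro ω hω
  by_contra hcon
  have h1 : ∀ j, k ≤ j → |Y (n₀ + j) ω| ≤ ε (n₀ + j) := by
    intro j hj
    obtain ⟨i, rfl⟩ := Nat.exists_eq_add_of_le hj
    by_contra hlt
    exact hcon (Set.mem_iUnion.2 ⟨i, not_le.1 hlt⟩)
  have h2 : ((k + 1 : ℕ) : ℝ≥0∞) ≤ k := le_trans hω (overlap_le_of_forall_le h1)
  have h3 : k + 1 ≤ k := by exact_mod_cast h2
  omega

theorem exp_ofReal_mul_natCast_rpow {p : ℝ} (hp : 0 < p) (n : ℕ) :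
    EReal.exp ((ENNReal.ofReal p * (n : ℝ≥0∞) ^ (1 / 3 : ℝ) : ℝ≥0∞) : EReal) =
      ENNReal.ofReal (Real.exp (p * (n : ℝ) ^ (1 / 3 : ℝ))) := by
  rw [← ENNReal.ofReal_natCast, ENNReal.ofReal_rpow_of_nonneg (by positivity) (by norm_num),
    ← ENNReal.ofReal_mul hp.le, EReal.coe_ennreal_ofReal, max_eq_left (by positivity),
    EReal.exp_coe]

/-- The last deviation bounds the number of deviations. -/
theorem exp_overlap_le {p : ℝ} (hp : 0 < p) (hn₀ : 1 ≤ n₀) :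
    EReal.exp ((ENNReal.ofReal p * (overlap Y ε n₀ ω) ^ (1 / 3 : ℝ) : ℝ≥0∞) : EReal) ≤
      1 + ∑' j : ℕ, Set.indicator {ω' | ε (n₀ + j) < |Y (n₀ + j) ω'|}
        (fun _ => ENNReal.ofReal (Real.exp (p * ((n₀ + j : ℕ) : ℝ) ^ (1 / 3 : ℝ)))) ω := by
  have hone : ∀ j : ℕ,
      1 ≤ ENNReal.ofReal (Real.exp (p * ((n₀ + j : ℕ) : ℝ) ^ (1 / 3 : ℝ))) := fun j => by
    rw [ENNReal.one_le_ofReal]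
    exact Real.one_le_exp (by positivity)
  have hle : overlap Y ε n₀ ω ≤ ∑' j : ℕ, Set.indicator {ω' | ε (n₀ + j) < |Y (n₀ + j) ω'|}
      (fun _ => ENNReal.ofReal (Real.exp (p * ((n₀ + j : ℕ) : ℝ) ^ (1 / 3 : ℝ)))) ω :=
    ENNReal.tsum_le_tsum fun j => Set.indicator_le_indicator (hone j)
  -- With infinitely many deviations there is no last one, but every weight is at least 1, so the
  -- right side is infinite too.
  rcases eq_or_ne (overlap Y ε n₀ ω) ⊤ with htop | htop
  · rw [htop, top_le_iff] at hle
    rw [hle]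
    simp
  set S : Set ℕ := {j | ε (n₀ + j) < |Y (n₀ + j) ω|} with hS
  have hSfin : S.Finite := by
    refine (ENNReal.finite_const_le_of_tsum_ne_top htop one_ne_zero).subset fun j hj => ?_
    have hj' : ω ∈ {ω' | ε (n₀ + j) < |Y (n₀ + j) ω'|} := hj
    show 1 ≤ Set.indicator {ω' | ε (n₀ + j) < |Y (n₀ + j) ω'|} (fun _ => (1 : ℝ≥0∞)) ω
    rw [Set.indicator_of_mem hj']
  rcases S.eq_empty_or_nonempty with hemp | hne
  · have h0 : overlap Y ε n₀ ω ≤ (0 : ℕ) := overlap_le_of_forall_le fun j _ => by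
      by_contra hlt
      have : j ∈ S := not_le.1 hlt
      rw [hemp] at this
      exact this
    have h1 : overlap Y ε n₀ ω = 0 := by simpa using h0
    rw [h1, ENNReal.zero_rpow_of_pos (by norm_num), mul_zero]
    simp
  · obtain ⟨j, hjS, hjmax⟩ := S.exists_max_image id hSfin hne
    have h1 : overlap Y ε n₀ ω ≤ (j + 1 : ℕ) := overlap_le_of_forall_le fun i hi => by
      by_contra hlt
      have : i ≤ j := hjmax i (not_le.1 hlt)
      omega
    -- Here n₀ ≥ 1 absorbs the off-by-one between count and last offset.
    have h2 : overlap Y ε n₀ ω ≤ (n₀ + j : ℕ) :=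
      h1.trans (by exact_mod_cast (by omega : j + 1 ≤ n₀ + j))
    calc _ ≤ EReal.exp
          ((ENNReal.ofReal p * ((n₀ + j : ℕ) : ℝ≥0∞) ^ (1 / 3 : ℝ) : ℝ≥0∞) : EReal) := by
          refine EReal.exp_monotone (EReal.coe_ennreal_le_coe_ennreal_iff.2 ?_)
          gcongr
      _ = ENNReal.ofReal (Real.exp (p * ((n₀ + j : ℕ) : ℝ) ^ (1 / 3 : ℝ))) :=
          exp_ofReal_mul_natCast_rpow hp _
      _ = Set.indicator {ω' | ε (n₀ + j) < |Y (n₀ + j) ω'|}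
          (fun _ => ENNReal.ofReal (Real.exp (p * ((n₀ + j : ℕ) : ℝ) ^ (1 / 3 : ℝ)))) ω := by
          have hj' : ω ∈ {ω' | ε (n₀ + j) < |Y (n₀ + j) ω'|} := hjS
          rw [Set.indicator_of_mem hj']
      _ ≤ _ := (ENNReal.le_tsum (f := fun j : ℕ =>
          Set.indicator {ω' | ε (n₀ + j) < |Y (n₀ + j) ω'|}
          (fun _ => ENNReal.ofReal (Real.exp (p * ((n₀ + j : ℕ) : ℝ) ^ (1 / 3 : ℝ)))) ω)
          j).trans le_add_self

variable {m : MeasurableSpace Ω} {μ : Measure Ω}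

theorem lintegral_overlap_eq (hY : ∀ n, Measurable (Y n)) :
    ∫⁻ ω, overlap Y ε n₀ ω ∂μ = ∑' j : ℕ, μ {ω | ε (n₀ + j) < |Y (n₀ + j) ω|} := by
  have hA : ∀ n, MeasurableSet {ω | ε n < |Y n ω|} := fun n =>
    measurableSet_lt measurable_const (hY n).norm
  simp only [overlap]
  rw [lintegral_tsum fun j => (measurable_const.indicator (hA _)).aemeasurable]
  simp [lintegral_indicator (hA _)]

theorem lintegral_exp_overlap_le [IsProbabilityMeasure μ] (hY : ∀ n, Measurable (Y n)) {p : ℝ}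
    (hp : 0 < p) (hn₀ : 1 ≤ n₀) :
    ∫⁻ ω, EReal.exp ((ENNReal.ofReal p * (overlap Y ε n₀ ω) ^ (1 / 3 : ℝ) : ℝ≥0∞) : EReal) ∂μ ≤
      1 + ∑' j : ℕ, ENNReal.ofReal (Real.exp (p * ((n₀ + j : ℕ) : ℝ) ^ (1 / 3 : ℝ))) *
        μ {ω | ε (n₀ + j) < |Y (n₀ + j) ω|} := by
  have hA : ∀ n, MeasurableSet {ω | ε n < |Y n ω|} := fun n =>
    measurableSet_lt measurable_const (hY n).norm
  refine (lintegral_mono fun ω => exp_overlap_le hp hn₀).trans (le_of_eq ?_)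
  rw [lintegral_add_left measurable_const,
    lintegral_tsum fun j => (measurable_const.indicator (hA _)).aemeasurable]
  simp [lintegral_indicator (hA _)]

end Overlap

/-! ### Borel–Cantelli and tails of the deviation series. -/

/-- The Borel–Cantelli lemma with an eventual summable bound. -/
theorem ae_eventually_notMem_of_eventually_le {Ω : Type*} {m : MeasurableSpace Ω} {μ : Measure Ω}
    {A : ℕ → Set Ω} {f : ℕ → ℝ} (hf : Summable f)
    (h : ∀ᶠ n in atTop, μ (A n) ≤ ENNReal.ofReal (f n)) :
    ∀ᵐ ω ∂μ, ∀ᶠ n in atTop, ω ∉ A n := by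
  obtain ⟨N, hN⟩ := eventually_atTop.1 h
  have hs : ∑' n, μ (A (n + N)) ≠ ⊤ :=
    ne_top_of_le_ne_top ((summable_nat_add_iff N).2 hf).tsum_ofReal_ne_top
      (ENNReal.tsum_le_tsum fun n => hN (n + N) (by omega))
  filter_upwards [ae_eventually_notMem hs] with ω hω
  obtain ⟨M, hM⟩ := eventually_atTop.1 hω
  refine eventually_atTop.2 ⟨M + N, fun n hn => ?_⟩
  have := hM (n - N) (by omega)
  rwa [Nat.sub_add_cancel (by omega)] at this

/-- Tails of the series `∑ exp (-β n ^ (1/3))`. -/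
theorem tsum_ofReal_exp_neg_cbrt_le {β : ℝ} (hβ : 0 < β) (n₀ : ℕ) {k : ℕ} :
    ∑' j : ℕ, ENNReal.ofReal (Real.exp (-(β * ((n₀ + (k + j) : ℕ) : ℝ) ^ (1 / 3 : ℝ)))) ≤
      ENNReal.ofReal ((8 * k + ∑' n : ℕ, Real.exp (-(β / 2) * (n : ℝ) ^ (1 / 3 : ℝ))) *
        Real.exp (-(β * (k : ℝ) ^ (1 / 3 : ℝ)))) := by
  have hS := summable_exp_neg_cbrt (half_pos hβ)
  have h8 : (8 : ℝ) ^ (1 / 3 : ℝ) = 2 := by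
    rw [show (8 : ℝ) = 2 ^ (3 : ℝ) by norm_num, ← Real.rpow_mul (by norm_num)]
    norm_num
  -- Since 8^(1/3) = 2, from j = 8k on half of the exponent already exceeds β k^(1/3) and the other
  -- half is kept for summation. The 8k earlier terms are each at most exp(-β k^(1/3)).
  have hterm : ∀ j : ℕ, Real.exp (-(β * ((n₀ + (k + j) : ℕ) : ℝ) ^ (1 / 3 : ℝ))) ≤
      Real.exp (-(β * (k : ℝ) ^ (1 / 3 : ℝ))) * ((if j < 8 * k then 1 else 0) +
        Real.exp (-(β / 2) * ((n₀ + k + j : ℕ) : ℝ) ^ (1 / 3 : ℝ))) := by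
    intro j
    rw [← add_assoc]
    split_ifs with hj
    · have h1 : (k : ℝ) ^ (1 / 3 : ℝ) ≤ ((n₀ + k + j : ℕ) : ℝ) ^ (1 / 3 : ℝ) :=
        Real.rpow_le_rpow (by positivity) (by exact_mod_cast (by omega)) (by norm_num)
      calc _ ≤ Real.exp (-(β * (k : ℝ) ^ (1 / 3 : ℝ))) * 1 := by
            rw [mul_one]
            exact Real.exp_le_exp.2 (by nlinarith)
        _ ≤ _ := by
            gcongr
            exact le_add_of_nonneg_right (Real.exp_pos _).le
    · have h1 : 2 * (k : ℝ) ^ (1 / 3 : ℝ) ≤ ((n₀ + k + j : ℕ) : ℝ) ^ (1 / 3 : ℝ) := by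
        rw [← h8, ← Real.mul_rpow (by norm_num) (by positivity)]
        exact Real.rpow_le_rpow (by positivity) (by exact_mod_cast (by omega)) (by norm_num)
      rw [zero_add, ← Real.exp_add]
      exact Real.exp_le_exp.2 (by nlinarith)
  have hSk : Summable fun j : ℕ => Real.exp (-(β / 2) * ((n₀ + k + j : ℕ) : ℝ) ^ (1 / 3 : ℝ)) := by
    simpa only [add_comm (n₀ + k)] using (summable_nat_add_iff (n₀ + k)).2 hS
  have hle : ∑' j : ℕ, Real.exp (-(β / 2) * ((n₀ + k + j : ℕ) : ℝ) ^ (1 / 3 : ℝ)) ≤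
      ∑' n : ℕ, Real.exp (-(β / 2) * (n : ℝ) ^ (1 / 3 : ℝ)) :=
    hSk.tsum_le_tsum_of_inj (fun j => n₀ + k + j) (add_right_injective _)
      (fun _ _ => (Real.exp_pos _).le) (fun _ => le_rfl) hS
  have hfin : HasSum (fun j : ℕ => if j < 8 * k then (1 : ℝ) else 0) (8 * k) := by
    have : HasSum (fun j : ℕ => if j < 8 * k then (1 : ℝ) else 0)
        (∑ j ∈ Finset.range (8 * k), if j < 8 * k then (1 : ℝ) else 0) :=
      hasSum_sum_of_ne_finset_zero (by intro j hj; simpa using hj)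
    convert this using 1
    rw [Finset.sum_congr rfl fun j hj => if_pos (Finset.mem_range.1 hj)]
    simp
  have hsum := (hfin.add hSk.hasSum).mul_left (Real.exp (-(β * (k : ℝ) ^ (1 / 3 : ℝ))))
  calc _ ≤ ∑' j : ℕ, ENNReal.ofReal (Real.exp (-(β * (k : ℝ) ^ (1 / 3 : ℝ))) *
        ((if j < 8 * k then 1 else 0) +
          Real.exp (-(β / 2) * ((n₀ + k + j : ℕ) : ℝ) ^ (1 / 3 : ℝ)))) :=
        ENNReal.tsum_le_tsum fun j => ENNReal.ofReal_le_ofReal (hterm j)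
    _ = ENNReal.ofReal (Real.exp (-(β * (k : ℝ) ^ (1 / 3 : ℝ))) * (8 * k +
          ∑' j : ℕ, Real.exp (-(β / 2) * ((n₀ + k + j : ℕ) : ℝ) ^ (1 / 3 : ℝ)))) := by
        rw [← ENNReal.ofReal_tsum_of_nonneg _ hsum.summable, hsum.tsum_eq]
        intro j
        split_ifs <;> positivity
    _ ≤ _ := by
        rw [mul_comm]
        gcongr

theorem weibullRate_pos {lam δ ε : ℝ} (hlam : 0 < lam) (hδ1 : δ < 1) (hε : 0 < ε) :
    0 < weibullRate lam δ ε := by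
  have : 0 < 1 - δ := by linarith
  rw [weibullRate]
  positivity

/-! ### Lambert's function on the nonnegative axis. -/

section LambertW

/-- A preimage exists in [0, z] by the intermediate value theorem, as 0 ≤ z ≤ z e^z. Uniqueness of
the preimage is never needed. -/
theorem lambertW_spec {z : ℝ} (hz : 0 ≤ z) :
    -1 ≤ lambertW z ∧ lambertW z * Real.exp (lambertW z) = z := by
  have hex : ∃ w ∈ Set.Ici (-1 : ℝ), w * Real.exp w = z := by
    have hc : ContinuousOn (fun w : ℝ => w * Real.exp w) (Set.Icc 0 z) := by fun_prop
    obtain ⟨w, hw, hwz⟩ := intermediate_value_Icc hz hc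
      (show z ∈ Set.Icc (0 * Real.exp 0) (z * Real.exp z) from
        ⟨by simpa using hz, le_mul_of_one_le_right hz (Real.one_le_exp hz)⟩)
    exact ⟨w, show (-1 : ℝ) ≤ w by linarith [hw.1], hwz⟩
  exact ⟨Function.invFunOn_mem hex, Function.invFunOn_eq hex⟩

theorem lambertW_pos {z : ℝ} (hz : 0 < z) : 0 < lambertW z := by
  have h := (lambertW_spec hz.le).2
  by_contra hw
  have := mul_nonpos_of_nonpos_of_nonneg (not_lt.1 hw) (Real.exp_pos (lambertW z)).le
  linarith

theorem le_lambertW {M z : ℝ} (hM : 0 < M) (hz : M * Real.exp M ≤ z) : M ≤ lambertW z := by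
  have hz0 : 0 < z := lt_of_lt_of_le (by positivity) hz
  have h := (lambertW_spec hz0.le).2
  have hw := lambertW_pos hz0
  by_contra hlt
  have hlt := not_le.1 hlt
  have : lambertW z * Real.exp (lambertW z) < M * Real.exp M :=
    mul_lt_mul hlt (Real.exp_le_exp.2 hlt.le) (Real.exp_pos _) hM.le
  linarith

/-- The closed form of the Ky Fan rate. -/
theorem lambertW_rate_eq {lam δ : ℝ} (hlam : 0 < lam) (hδ1 : δ < 1) {n : ℕ} (hn : 1 ≤ n) :
    3 * √3 * lambertW ((1 - δ) / 3 * lam ^ (2 / 3 : ℝ) * (n : ℝ) ^ (1 / 3 : ℝ)) ^ (3 / 2 : ℝ) /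
      ((1 - δ) ^ (3 / 2 : ℝ) * lam * √(n : ℝ)) =
    Real.exp (-lambertW ((1 - δ) / 3 * lam ^ (2 / 3 : ℝ) * (n : ℝ) ^ (1 / 3 : ℝ))) ^
      (3 / 2 : ℝ) := by
  have hδ : 0 < 1 - δ := by linarith
  have hn0 : (0 : ℝ) < n := by exact_mod_cast hn
  set z := (1 - δ) / 3 * lam ^ (2 / 3 : ℝ) * (n : ℝ) ^ (1 / 3 : ℝ) with hz
  have hz0 : 0 < z := by positivity
  set w := lambertW z
  have hw : 0 < w := lambertW_pos hz0
  have hwz : w * Real.exp w = z := (lambertW_spec hz0.le).2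
  have hq : Real.exp (-w) = w / z := by
    rw [Real.exp_neg, ← hwz]
    field_simp
  have h3 : (3 : ℝ) ^ (3 / 2 : ℝ) = 3 * √3 := by
    rw [show (3 / 2 : ℝ) = 1 + 1 / 2 by norm_num, Real.rpow_add (by norm_num), Real.rpow_one,
      Real.sqrt_eq_rpow]
  have hz32 : z ^ (3 / 2 : ℝ) = (1 - δ) ^ (3 / 2 : ℝ) / (3 * √3) * lam * √(n : ℝ) := by
    rw [hz, Real.mul_rpow (by positivity) (by positivity),
      Real.mul_rpow (by positivity) (by positivity), Real.div_rpow hδ.le (by norm_num), h3,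
      ← Real.rpow_mul hlam.le, ← Real.rpow_mul hn0.le, Real.sqrt_eq_rpow (n : ℝ)]
    norm_num
  rw [hq, Real.div_rpow hw.le hz0.le, hz32]
  field_simp

end LambertW

/-! ### Thresholds in n and the logarithmic tolerance. -/

section Thresholds

theorem tendsto_natCast_cbrt_atTop :
    Tendsto (fun n : ℕ => (n : ℝ) ^ (1 / 3 : ℝ)) atTop atTop :=
  (tendsto_rpow_atTop (by norm_num)).comp tendsto_natCast_atTop_atTop

theorem exists_forall_le_mul_cbrt {a : ℝ} (ha : 0 < a) (U : ℝ) :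
    ∃ N : ℕ, ∀ n : ℕ, N ≤ n → U ≤ a * (n : ℝ) ^ (1 / 3 : ℝ) :=
  eventually_atTop.1 ((tendsto_natCast_cbrt_atTop.const_mul_atTop ha).eventually_ge_atTop U)

theorem exists_forall_le_lambertW {a : ℝ} (ha : 0 < a) (M : ℝ) :
    ∃ N : ℕ, ∀ n : ℕ, N ≤ n → M ≤ lambertW (a * (n : ℝ) ^ (1 / 3 : ℝ)) := by
  obtain ⟨N, hN⟩ := exists_forall_le_mul_cbrt ha (max M 1 * Real.exp (max M 1))
  exact ⟨N, fun n hn => (le_max_left _ _).trans (le_lambertW (by positivity) (hN n hn))⟩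

theorem logTolerance_rpow_mul {lam δ θ : ℝ} (hlam : 0 < lam) (hδ1 : δ < 1) (hθ : 0 < θ) {n : ℕ}
    (hn : 1 ≤ n) :
    logTolerance lam δ θ n ^ (2 / 3 : ℝ) * (n : ℝ) ^ (1 / 3 : ℝ) =
      (2 * (1 + θ) / ((1 - δ) * lam ^ (2 / 3 : ℝ))) ^ (2 / 3 : ℝ) * Real.log (n + 1) ^ 2 := by
  have hδ : 0 < 1 - δ := by linarith
  have hn0 : (0 : ℝ) < n := by exact_mod_cast hn
  have hlog : 0 < Real.log (n + 1) := Real.log_pos (by linarith)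
  have h1 : (Real.log (n + 1) ^ 3) ^ (2 / 3 : ℝ) = Real.log (n + 1) ^ 2 := by
    rw [← Real.rpow_natCast, ← Real.rpow_mul hlog.le, ← Real.rpow_natCast]
    norm_num
  have h2 : √(n : ℝ) ^ (2 / 3 : ℝ) = (n : ℝ) ^ (1 / 3 : ℝ) := by
    rw [Real.sqrt_eq_rpow, ← Real.rpow_mul hn0.le]
    norm_num
  have h3 : (n : ℝ) ^ (1 / 3 : ℝ) ≠ 0 := by positivity
  rw [logTolerance, Real.mul_rpow (by positivity) (by positivity),
    Real.div_rpow (by positivity) (by positivity), h1, h2]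
  field_simp

theorem logTolerance_pos {lam δ θ : ℝ} (hlam : 0 < lam) (hδ1 : δ < 1) (hθ : 0 < θ) {n : ℕ}
    (hn : 1 ≤ n) : 0 < logTolerance lam δ θ n := by
  have hδ : 0 < 1 - δ := by linarith
  have hn0 : (0 : ℝ) < n := by exact_mod_cast hn
  have hlog : 0 < Real.log (n + 1) := Real.log_pos (by linarith)
  rw [logTolerance]
  positivity

/-- Along this tolerance u is a constant times log²(n+1), which eventually beats any constant and
any multiple of log(n+1). -/
theorem exists_logTolerance_threshold {lam δ θ : ℝ} (hlam : 0 < lam) (hδ1 : δ < 1) (hθ : 0 < θ)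
    (U : ℝ) :
    ∃ N : ℕ, ∀ n : ℕ, 1 ≤ n → N ≤ n →
      U ≤ lam ^ (2 / 3 : ℝ) * logTolerance lam δ θ n ^ (2 / 3 : ℝ) * (n : ℝ) ^ (1 / 3 : ℝ) ∧
      Real.exp (-(weibullRate lam δ (logTolerance lam δ θ n) * (n : ℝ) ^ (1 / 3 : ℝ))) ≤
        1 / (n : ℝ) ^ 2 ∧
      1 / (n : ℝ) ^ 2 ≤ 1 / ((n : ℝ) * Real.log ((n : ℝ) + 1) ^ (1 + θ)) := by
  have hδ : 0 < 1 - δ := by linarith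
  set κ := (2 * (1 + θ) / ((1 - δ) * lam ^ (2 / 3 : ℝ))) ^ (2 / 3 : ℝ) with hκ
  have hκ0 : 0 < κ := by positivity
  set r := (1 - δ) / 2 * lam ^ (2 / 3 : ℝ) * κ with hr
  have hr0 : 0 < r := by positivity
  have hcast : Tendsto (fun n : ℕ => (n : ℝ) + 1) atTop atTop :=
    tendsto_atTop_add_const_right _ _ tendsto_natCast_atTop_atTop
  have hlog : Tendsto (fun n : ℕ => Real.log ((n : ℝ) + 1)) atTop atTop :=
    Real.tendsto_log_atTop.comp hcast
  have ev1 := (hlog.const_mul_atTop hr0).eventually_ge_atTop 2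
  have ev2 := hlog.eventually_ge_atTop 1
  have ev3 := hlog.eventually_ge_atTop (U / (lam ^ (2 / 3 : ℝ) * κ))
  -- The factor 1/2 turns the bound by n + 1 into one by n, as (n + 1)/2 ≤ n.
  have ev4 : ∀ᶠ n : ℕ in atTop,
      ‖Real.log ((n : ℝ) + 1) ^ (1 + θ)‖ ≤ 1 / 2 * ‖((n : ℝ) + 1) ^ (1 : ℝ)‖ :=
    hcast.eventually ((isLittleO_log_rpow_rpow_atTop (1 + θ) one_pos).def (by norm_num))
  obtain ⟨N, hN⟩ := eventually_atTop.1 (ev1.and (ev2.and (ev3.and ev4)))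
  refine ⟨N, fun n hn hNn => ?_⟩
  obtain ⟨h1, h2, h3, h4⟩ := hN n hNn
  have hn1 : (1 : ℝ) ≤ n := by exact_mod_cast hn
  have hpow := logTolerance_rpow_mul hlam hδ1 hθ hn
  rw [← hκ] at hpow
  set L := Real.log ((n : ℝ) + 1) with hL
  have hexpL : Real.exp L = n + 1 := Real.exp_log (by linarith)
  refine ⟨?_, ?_, ?_⟩
  · rw [mul_assoc, hpow]
    rw [div_le_iff₀ (by positivity)] at h3
    have : 0 < lam ^ (2 / 3 : ℝ) * κ := by positivity
    calc U ≤ L * (lam ^ (2 / 3 : ℝ) * κ) := h3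
      _ ≤ L ^ 2 * (lam ^ (2 / 3 : ℝ) * κ) := by
        gcongr
        nlinarith
      _ = _ := by ring
  · have he : weibullRate lam δ (logTolerance lam δ θ n) * (n : ℝ) ^ (1 / 3 : ℝ) = r * L ^ 2 := by
      rw [weibullRate, mul_assoc, hpow, hr]
      ring
    rw [he]
    calc Real.exp (-(r * L ^ 2)) ≤ Real.exp (-(L + L)) := by
          refine Real.exp_le_exp.2 ?_
          nlinarith
      _ = 1 / ((n : ℝ) + 1) ^ 2 := by
          rw [Real.exp_neg, Real.exp_add, hexpL, one_div, sq]
      _ ≤ 1 / (n : ℝ) ^ 2 := by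
          gcongr
          linarith
  · rw [Real.rpow_one, Real.norm_of_nonneg (by positivity),
      Real.norm_of_nonneg (by positivity)] at h4
    have hLp : 0 < L ^ (1 + θ) := by positivity
    refine one_div_le_one_div_of_le (by positivity) ?_
    rw [sq]
    gcongr
    linarith

end Thresholds

/-! ### Consequences of the deviation inequality. -/

namespace IsExpMartingale

variable {Ω : Type*} {m : MeasurableSpace Ω} {μ : Measure Ω} {ℱ : Filtration ℕ m}
  {X : ℕ → Ω → ℝ} {lam K δ : ℝ}

theorem measurable_div (h : IsExpMartingale μ ℱ X lam K) (n : ℕ) :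
    Measurable (fun ω => X n ω / n) :=
  (((h.martingale.stronglyMeasurable n).mono (ℱ.le n)).measurable).div_const _

variable [IsProbabilityMeasure μ]

/-- The weight n^(2/3) in `weibullConst` is pure slack: the argument gives the series without it. -/
theorem lintegral_exp_overlap_le_of_measure_le (h : IsExpMartingale μ ℱ X lam K) {ε β : ℝ}
    {N n₀ : ℕ}
    (hN : ∀ n : ℕ, 1 ≤ n → N ≤ n → μ {ω | ε < |X n ω / n|} ≤
      ENNReal.ofReal (Real.exp (-(β * (n : ℝ) ^ (1 / 3 : ℝ)))))
    (hn₀ : 1 ≤ n₀) (hNn₀ : N ≤ n₀) {p : ℝ} (hp : 0 < p) :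
    ∫⁻ ω, EReal.exp ((ENNReal.ofReal p *
      (overlap (fun n ω => X n ω / n) (fun _ => ε) n₀ ω) ^ (1 / 3 : ℝ) : ℝ≥0∞) : EReal) ∂μ
      ≤ 1 + weibullConst β p n₀ := by
  refine (lintegral_exp_overlap_le h.measurable_div hp hn₀).trans ?_
  rw [weibullConst]
  gcongr with j
  refine (mul_le_mul_right (hN (n₀ + j) (by omega) (by omega)) _).trans ?_
  rw [← ENNReal.ofReal_mul (Real.exp_pos _).le, ← Real.exp_add]
  refine ENNReal.ofReal_le_ofReal ?_
  have h1 : (1 : ℝ) ≤ ((n₀ + j : ℕ) : ℝ) := by exact_mod_cast (by omega : 1 ≤ n₀ + j)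
  calc _ = 1 * Real.exp (-(β - p) * ((n₀ + j : ℕ) : ℝ) ^ (1 / 3 : ℝ)) := by
        rw [one_mul]; ring_nf
    _ ≤ _ := by
        gcongr
        exact Real.one_le_rpow h1 (by norm_num)

/-- Below the threshold `N` the probabilities are bounded by one. -/
theorem lintegral_exp_overlap_le_tsum (h : IsExpMartingale μ ℱ X lam K) {ε β : ℝ} {N n₀ : ℕ}
    (hN : ∀ n : ℕ, 1 ≤ n → N ≤ n → μ {ω | ε < |X n ω / n|} ≤
      ENNReal.ofReal (Real.exp (-(β * (n : ℝ) ^ (1 / 3 : ℝ)))))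
    (hn₀ : 1 ≤ n₀) {p : ℝ} (hp : 0 < p) (hpβ : p < β) :
    ∫⁻ ω, EReal.exp ((ENNReal.ofReal p *
      (overlap (fun n ω => X n ω / n) (fun _ => ε) n₀ ω) ^ (1 / 3 : ℝ) : ℝ≥0∞) : EReal) ∂μ
      ≤ ENNReal.ofReal (1 + ∑' j : ℕ, if N ≤ n₀ + j then
          Real.exp (-(β - p) * ((n₀ + j : ℕ) : ℝ) ^ (1 / 3 : ℝ)) else
          Real.exp (p * ((n₀ + j : ℕ) : ℝ) ^ (1 / 3 : ℝ))) := by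
  refine (lintegral_exp_overlap_le h.measurable_div hp hn₀).trans ?_
  have hnn : ∀ j : ℕ, 0 ≤ if N ≤ n₀ + j then
      Real.exp (-(β - p) * ((n₀ + j : ℕ) : ℝ) ^ (1 / 3 : ℝ)) else
      Real.exp (p * ((n₀ + j : ℕ) : ℝ) ^ (1 / 3 : ℝ)) := fun j => by
    split_ifs <;> positivity
  have hs : Summable fun j : ℕ => if N ≤ n₀ + j then
      Real.exp (-(β - p) * ((n₀ + j : ℕ) : ℝ) ^ (1 / 3 : ℝ)) else
      Real.exp (p * ((n₀ + j : ℕ) : ℝ) ^ (1 / 3 : ℝ)) := by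
    have h1 : Summable fun j : ℕ =>
        Real.exp (-(β - p) * ((n₀ + j : ℕ) : ℝ) ^ (1 / 3 : ℝ)) := by
      simpa only [add_comm n₀] using
        (summable_nat_add_iff n₀).2 (summable_exp_neg_cbrt (sub_pos.2 hpβ))
    -- Only finitely many terms lie below the threshold.
    refine h1.congr_atTop ?_
    filter_upwards [eventually_ge_atTop N] with j hj
    rw [if_pos (by omega)]
  rw [ENNReal.ofReal_add zero_le_one (tsum_nonneg hnn), ENNReal.ofReal_one,
    ENNReal.ofReal_tsum_of_nonneg hnn hs]
  gcongr with j
  split_ifs with hj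
  · refine (mul_le_mul_right (hN (n₀ + j) (by omega) hj) _).trans ?_
    rw [← ENNReal.ofReal_mul (Real.exp_pos _).le, ← Real.exp_add]
    refine ENNReal.ofReal_le_ofReal (le_of_eq ?_)
    ring_nf
  · exact mul_le_of_le_one_right' prob_le_one

/-- For k - 1 ≥ N a union bound over the late deviations applies. For k - 1 < N the first summand
alone makes the right side at least 1. -/
theorem measure_le_overlap_le {ε β : ℝ} {N n₀ : ℕ} (hβ : 0 < β)
    (hN : ∀ n : ℕ, 1 ≤ n → N ≤ n → μ {ω | ε < |X n ω / n|} ≤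
      ENNReal.ofReal (Real.exp (-(β * (n : ℝ) ^ (1 / 3 : ℝ)))))
    (hn₀ : 1 ≤ n₀) {p : ℝ} (hpβ : p < β) {k : ℕ} (hk : 2 ≤ k) :
    μ {ω | (k : ℝ≥0∞) ≤ overlap (fun n ω => X n ω / n) (fun _ => ε) n₀ ω} ≤
      ENNReal.ofReal ((Real.exp (β * (N : ℝ) ^ (1 / 3 : ℝ)) +
        (∑' n : ℕ, Real.exp (-(β / 2) * (n : ℝ) ^ (1 / 3 : ℝ))) +
        8 * ((k : ℝ) - 1) ^ (2 - 1 / 3 : ℝ)) * Real.exp (-p * ((k : ℝ) - 1) ^ (1 / 3 : ℝ))) := by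
  obtain ⟨l, rfl⟩ : ∃ l, k = l + 1 := ⟨k - 1, by omega⟩
  have hl : (1 : ℝ) ≤ l := by exact_mod_cast (by omega : 1 ≤ l)
  have hcast : ((l + 1 : ℕ) : ℝ) - 1 = l := by push_cast; ring
  rw [hcast]
  have hS : 0 ≤ ∑' n : ℕ, Real.exp (-(β / 2) * (n : ℝ) ^ (1 / 3 : ℝ)) :=
    tsum_nonneg fun n => (Real.exp_pos _).le
  rcases le_or_gt N l with hNl | hNl
  · refine (measure_mono (setOf_le_overlap_subset l)).trans ((measure_iUnion_le _).trans ?_)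
    refine (ENNReal.tsum_le_tsum fun j => hN (n₀ + (l + j)) (by omega) (by omega)).trans ?_
    refine (tsum_ofReal_exp_neg_cbrt_le hβ n₀).trans (ENNReal.ofReal_le_ofReal ?_)
    have h1 : (l : ℝ) ≤ (l : ℝ) ^ (2 - 1 / 3 : ℝ) := Real.self_le_rpow_of_one_le hl (by norm_num)
    have h2 : -(β * (l : ℝ) ^ (1 / 3 : ℝ)) ≤ -p * (l : ℝ) ^ (1 / 3 : ℝ) := by
      have := Real.rpow_nonneg (by linarith : (0 : ℝ) ≤ l) (1 / 3)
      nlinarith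
    have h3 := Real.exp_pos (β * (N : ℝ) ^ (1 / 3 : ℝ))
    exact mul_le_mul (by linarith) (Real.exp_le_exp.2 h2) (Real.exp_pos _).le (by positivity)
  · refine prob_le_one.trans ?_
    rw [ENNReal.one_le_ofReal]
    have h1 : (l : ℝ) ^ (1 / 3 : ℝ) ≤ (N : ℝ) ^ (1 / 3 : ℝ) :=
      Real.rpow_le_rpow (by positivity) (by exact_mod_cast hNl.le) (by norm_num)
    have h0 := Real.rpow_nonneg (by linarith : (0 : ℝ) ≤ l) (1 / 3)
    calc (1 : ℝ) ≤ Real.exp (β * (N : ℝ) ^ (1 / 3 : ℝ) + -p * (l : ℝ) ^ (1 / 3 : ℝ)) := by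
          refine Real.one_le_exp ?_
          nlinarith
      _ = Real.exp (β * (N : ℝ) ^ (1 / 3 : ℝ)) * Real.exp (-p * (l : ℝ) ^ (1 / 3 : ℝ)) :=
          Real.exp_add _ _
      _ ≤ _ := by
          gcongr
          have : 0 ≤ 8 * (l : ℝ) ^ (2 - 1 / 3 : ℝ) := by positivity
          linarith

/-- The strong law of large numbers. -/
theorem tendsto_div_ae (h : IsExpMartingale μ ℱ X lam K) (hlam : 0 < lam) (hK : 0 < K)
    (hδ0 : 0 < δ) (hδ1 : δ < 1) : ∀ᵐ ω ∂μ, Tendsto (fun n : ℕ => X n ω / n) atTop (𝓝 0) := by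
  have hev : ∀ i : ℕ, ∀ᵐ ω ∂μ, ∀ᶠ n : ℕ in atTop,
      ω ∉ {ω | 1 / ((i : ℝ) + 1) < |X n ω / n|} := by
    intro i
    have hε : 0 < 1 / ((i : ℝ) + 1) := by positivity
    refine ae_eventually_notMem_of_eventually_le
      (summable_exp_neg_cbrt (weibullRate_pos (δ := δ) hlam hδ1 hε)) ?_
    obtain ⟨N, hN⟩ := exists_forall_le_mul_cbrt
      (show 0 < lam ^ (2 / 3 : ℝ) * (1 / ((i : ℝ) + 1)) ^ (2 / 3 : ℝ) by positivity)
      (12 / δ + 8 * K / δ ^ 2)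
    filter_upwards [eventually_ge_atTop N, eventually_ge_atTop 1] with n hNn hn
    rw [neg_mul]
    exact h.measure_deviation_le hlam hK hδ0 hδ1 hn hε (hN n hNn)
  filter_upwards [ae_all_iff.2 hev] with ω hω
  rw [Metric.tendsto_nhds]
  intro ε hε
  obtain ⟨i, hi⟩ := exists_nat_one_div_lt hε
  filter_upwards [hω i] with n hn
  rw [Real.dist_eq, sub_zero]
  exact (not_lt.1 hn).trans_lt hi

/-- Writing η = e^(-3w/2), the equation exp(-β(η) n^(1/3)) = η becomes w e^w = (1-δ)/3 · λ^(2/3)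
n^(1/3). Such an η is admissible in the infimum, and `hw` is the requirement that u = 3w/(1-δ) be
large enough. -/
theorem kyFanDist_le (h : IsExpMartingale μ ℱ X lam K) (hlam : 0 < lam) (hK : 0 < K)
    (hδ0 : 0 < δ) (hδ1 : δ < 1) {n : ℕ} (hn : 1 ≤ n)
    (hw : (12 / δ + 8 * K / δ ^ 2) * (1 - δ) / 3 ≤
      lambertW ((1 - δ) / 3 * lam ^ (2 / 3 : ℝ) * (n : ℝ) ^ (1 / 3 : ℝ))) :
    kyFanDist μ (fun ω => X n ω / n) (fun _ => 0) ≤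
      3 * √3 * lambertW ((1 - δ) / 3 * lam ^ (2 / 3 : ℝ) * (n : ℝ) ^ (1 / 3 : ℝ)) ^ (3 / 2 : ℝ) /
        ((1 - δ) ^ (3 / 2 : ℝ) * lam * √(n : ℝ)) := by
  have hδ : 0 < 1 - δ := by linarith
  have hn0 : (0 : ℝ) < n := by exact_mod_cast hn
  rw [lambertW_rate_eq hlam hδ1 hn]
  set z := (1 - δ) / 3 * lam ^ (2 / 3 : ℝ) * (n : ℝ) ^ (1 / 3 : ℝ) with hz
  have hz0 : 0 < z := by positivity
  set w := lambertW z
  have hwz : w * Real.exp w = z := (lambertW_spec hz0.le).2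
  have hzq : z * Real.exp (-w) = w := by
    rw [← hwz, mul_assoc, ← Real.exp_add]; simp
  set η := Real.exp (-w) ^ (3 / 2 : ℝ) with hη
  have hη0 : 0 < η := by positivity
  have hη23 : η ^ (2 / 3 : ℝ) = Real.exp (-w) := by
    rw [hη, ← Real.rpow_mul (Real.exp_pos _).le]; norm_num
  have hu : lam ^ (2 / 3 : ℝ) * η ^ (2 / 3 : ℝ) * (n : ℝ) ^ (1 / 3 : ℝ) = 3 * w / (1 - δ) := by
    have h3 : 3 * w / (1 - δ) = 3 * (z * Real.exp (-w)) / (1 - δ) := by rw [hzq]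
    rw [hη23, h3, hz]
    field_simp
  have hrate : weibullRate lam δ η * (n : ℝ) ^ (1 / 3 : ℝ) = 3 / 2 * w := by
    calc _ = (1 - δ) / 2 * (lam ^ (2 / 3 : ℝ) * η ^ (2 / 3 : ℝ) * (n : ℝ) ^ (1 / 3 : ℝ)) := by
          rw [weibullRate]; ring
      _ = _ := by rw [hu]; field_simp
  have hdev := h.measure_deviation_le hlam hK hδ0 hδ1 hn hη0 (by
    rw [hu, le_div_iff₀ hδ]; linarith)
  have hexp : Real.exp (-(3 / 2 * w)) = η := by
    rw [hη, ← Real.exp_mul]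
    ring_nf
  rw [hrate, hexp] at hdev
  refine csInf_le ⟨0, fun x hx => hx.1.le⟩ ⟨hη0, ?_⟩
  simpa only [sub_zero] using hdev

theorem limsup_le_one (h : IsExpMartingale μ ℱ X lam K) (hlam : 0 < lam) (hK : 0 < K)
    (hδ0 : 0 < δ) (hδ1 : δ < 1) {θ : ℝ} (hθ : 0 < θ) :
    ∀ᵐ ω ∂μ, limsup (fun n : ℕ =>
      ((|X n ω / n| * (logTolerance lam δ θ n)⁻¹ : ℝ) : EReal)) atTop ≤ 1 := by
  obtain ⟨N, hN⟩ := exists_logTolerance_threshold hlam hδ1 hθ (12 / δ + 8 * K / δ ^ 2)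
  have hev : ∀ᵐ ω ∂μ, ∀ᶠ n : ℕ in atTop, ω ∉ {ω | logTolerance lam δ θ n < |X n ω / n|} := by
    refine ae_eventually_notMem_of_eventually_le
      (Real.summable_one_div_nat_pow.2 (by norm_num : 1 < 2)) ?_
    filter_upwards [eventually_ge_atTop N, eventually_ge_atTop 1] with n hNn hn
    exact (h.measure_deviation_le hlam hK hδ0 hδ1 hn (logTolerance_pos hlam hδ1 hθ hn)
      (hN n hn hNn).1).trans (ENNReal.ofReal_le_ofReal (hN n hn hNn).2.1)
  filter_upwards [hev] with ω hω
  refine limsup_le_of_le (by isBoundedDefault) ?_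
  filter_upwards [hω, eventually_ge_atTop 1] with n hn hn1
  have hpos := logTolerance_pos hlam hδ1 hθ hn1
  have hle : |X n ω / n| * (logTolerance lam δ θ n)⁻¹ ≤ 1 := by
    rw [← div_eq_mul_inv, div_le_one hpos]
    exact not_lt.1 hn
  exact_mod_cast hle

end IsExpMartingale

/-! ### Assembly with constants independent of the probability space. -/

theorem mainTheorem9 (lam K δ : ℝ) (hlam : 0 < lam) (hK : 0 < K) (hδ0 : 0 < δ) (hδ1 : δ < 1) :
    ∃ (N : ℝ → ℕ) (C : ℝ → ℕ → ℝ → ℝ) (d D : ℝ → ℕ → ℝ) (N' : ℕ) (N'' : ℝ → ℕ),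
      ∀ (Ω : Type*) (m : MeasurableSpace Ω) (μ : Measure Ω) (_ : IsProbabilityMeasure μ)
        (ℱ : Filtration ℕ m) (X : ℕ → Ω → ℝ), IsExpMartingale μ ℱ X lam K →
      -- the strong law
      (∀ᵐ ω ∂μ, Tendsto (fun n : ℕ => X n ω / n) atTop (𝓝 0)) ∧
      -- (a) fixed tolerance: Weibull moments and tails
      (∀ ε : ℝ, 0 < ε → ∀ n₀ : ℕ, 1 ≤ n₀ →
        (∀ p : ℝ, 0 < p → p < weibullRate lam δ ε →
          ∫⁻ ω, EReal.exp ((ENNReal.ofReal p *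
              (overlap (fun n ω => X n ω / n) (fun _ => ε) n₀ ω) ^ (1 / 3 : ℝ) : ℝ≥0∞) : EReal) ∂μ
            ≤ ENNReal.ofReal (C ε n₀ p)) ∧
        (N ε ≤ n₀ → ∀ p : ℝ, 0 < p → p < weibullRate lam δ ε →
          ∫⁻ ω, EReal.exp ((ENNReal.ofReal p *
              (overlap (fun n ω => X n ω / n) (fun _ => ε) n₀ ω) ^ (1 / 3 : ℝ) : ℝ≥0∞) : EReal) ∂μ
            ≤ 1 + weibullConst (weibullRate lam δ ε) p n₀ ∧
          weibullConst (weibullRate lam δ ε) p n₀ < ∞) ∧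
        0 < d ε n₀ ∧ 0 < D ε n₀ ∧
        (∀ p : ℝ, 0 < p → p < weibullRate lam δ ε → ∀ k : ℕ, 2 ≤ k →
          μ {ω | (k : ℝ≥0∞) ≤ overlap (fun n ω => X n ω / n) (fun _ => ε) n₀ ω}
            ≤ ENNReal.ofReal ((d ε n₀ + D ε n₀ * ((k : ℝ) - 1) ^ (2 - 1 / 3 : ℝ)) *
                Real.exp (-p * ((k : ℝ) - 1) ^ (1 / 3 : ℝ))))) ∧
      -- (b) the Ky Fan rate
      (∀ n : ℕ, 1 ≤ n → N' ≤ n →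
        kyFanDist μ (fun ω => X n ω / n) (fun _ => 0) ≤
          3 * √3 * lambertW ((1 - δ) / 3 * lam ^ (2 / 3 : ℝ) * (n : ℝ) ^ (1 / 3 : ℝ)) ^ (3 / 2 : ℝ) /
            ((1 - δ) ^ (3 / 2 : ℝ) * lam * √(n : ℝ))) ∧
      -- (c) the almost sure rate and its mean deviation frequency
      (∀ θ : ℝ, 0 < θ →
        (∀ᵐ ω ∂μ, limsup (fun n : ℕ =>
          ((|X n ω / n| * (logTolerance lam δ θ n)⁻¹ : ℝ) : EReal)) atTop ≤ 1) ∧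
        (∀ n₀ : ℕ, 1 ≤ n₀ → N'' θ ≤ n₀ →
          ∫⁻ ω, overlap (fun n ω => X n ω / n) (logTolerance lam δ θ) n₀ ω ∂μ
            ≤ ∑' j : ℕ, ENNReal.ofReal
              (1 / (((n₀ + j : ℕ) : ℝ) * Real.log (((n₀ + j : ℕ) : ℝ) + 1) ^ (1 + θ))))) := by
  have hthr : ∀ ε : ℝ, ∃ N : ℕ, 0 < ε → ∀ n : ℕ, N ≤ n →
      12 / δ + 8 * K / δ ^ 2 ≤
        lam ^ (2 / 3 : ℝ) * ε ^ (2 / 3 : ℝ) * (n : ℝ) ^ (1 / 3 : ℝ) := by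
    intro ε
    by_cases hε : 0 < ε
    · obtain ⟨N, hN⟩ := exists_forall_le_mul_cbrt
        (show 0 < lam ^ (2 / 3 : ℝ) * ε ^ (2 / 3 : ℝ) by positivity) (12 / δ + 8 * K / δ ^ 2)
      exact ⟨N, fun _ => hN⟩
    -- A dummy value for ε ≤ 0 makes the threshold a total function of ε.
    · exact ⟨0, fun h => absurd h hε⟩
  choose N hN using hthr
  have hthr'' : ∀ θ : ℝ, ∃ N : ℕ, 0 < θ → ∀ n : ℕ, 1 ≤ n → N ≤ n →
      12 / δ + 8 * K / δ ^ 2 ≤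
        lam ^ (2 / 3 : ℝ) * logTolerance lam δ θ n ^ (2 / 3 : ℝ) * (n : ℝ) ^ (1 / 3 : ℝ) ∧
      Real.exp (-(weibullRate lam δ (logTolerance lam δ θ n) * (n : ℝ) ^ (1 / 3 : ℝ))) ≤
        1 / (n : ℝ) ^ 2 ∧
      1 / (n : ℝ) ^ 2 ≤ 1 / ((n : ℝ) * Real.log ((n : ℝ) + 1) ^ (1 + θ)) := by
    intro θ
    by_cases hθ : 0 < θ
    · obtain ⟨N, hN⟩ := exists_logTolerance_threshold hlam hδ1 hθ (12 / δ + 8 * K / δ ^ 2)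
      exact ⟨N, fun _ => hN⟩
    · exact ⟨0, fun h => absurd h hθ⟩
  choose N'' hN'' using hthr''
  have hδ : 0 < 1 - δ := by linarith
  obtain ⟨N', hN'⟩ := exists_forall_le_lambertW
    (show 0 < (1 - δ) / 3 * lam ^ (2 / 3 : ℝ) by positivity)
    ((12 / δ + 8 * K / δ ^ 2) * (1 - δ) / 3)
  -- In C, indices below N ε use the trivial bound 1 on the probability. In d, the exponential
  -- covers k - 1 < N ε and the series comes from the tail estimate, whose initial block of length
  -- 8k yields D = 8.
  refine ⟨N,
    fun ε n₀ p => 1 + ∑' j : ℕ, if N ε ≤ n₀ + j then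
      Real.exp (-(weibullRate lam δ ε - p) * ((n₀ + j : ℕ) : ℝ) ^ (1 / 3 : ℝ)) else
      Real.exp (p * ((n₀ + j : ℕ) : ℝ) ^ (1 / 3 : ℝ)),
    fun ε _ => Real.exp (weibullRate lam δ ε * (N ε : ℝ) ^ (1 / 3 : ℝ)) +
      ∑' n : ℕ, Real.exp (-(weibullRate lam δ ε / 2) * (n : ℝ) ^ (1 / 3 : ℝ)),
    fun _ _ => 8, N', N'', fun Ω m μ _ ℱ X h => ⟨?_, ?_, ?_, ?_⟩⟩
  · exact h.tendsto_div_ae hlam hK hδ0 hδ1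
  · intro ε hε n₀ hn₀
    have hdev : ∀ n : ℕ, 1 ≤ n → N ε ≤ n → μ {ω | ε < |X n ω / n|} ≤
        ENNReal.ofReal (Real.exp (-(weibullRate lam δ ε * (n : ℝ) ^ (1 / 3 : ℝ)))) :=
      fun n hn hNn => h.measure_deviation_le hlam hK hδ0 hδ1 hn hε (hN ε hε n hNn)
    refine ⟨fun p hp hpβ => h.lintegral_exp_overlap_le_tsum hdev hn₀ hp hpβ,
      fun hNn₀ p hp hpβ => ⟨h.lintegral_exp_overlap_le_of_measure_le hdev hn₀ hNn₀ hp,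
        weibullConst_lt_top hpβ n₀⟩, ?_, by norm_num, fun p _ hpβ k hk => ?_⟩
    · exact add_pos_of_pos_of_nonneg (Real.exp_pos _) (tsum_nonneg fun n => (Real.exp_pos _).le)
    · exact IsExpMartingale.measure_le_overlap_le (weibullRate_pos hlam hδ1 hε) hdev hn₀ hpβ hk
  · exact fun n hn hNn => h.kyFanDist_le hlam hK hδ0 hδ1 hn (hN' n hNn)
  · refine fun θ hθ => ⟨h.limsup_le_one hlam hK hδ0 hδ1 hθ, fun n₀ hn₀ hNn₀ => ?_⟩
    rw [lintegral_overlap_eq h.measurable_div]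
    refine ENNReal.tsum_le_tsum fun j => ?_
    obtain ⟨h1, h2, h3⟩ := hN'' θ hθ (n₀ + j) (by omega) (by omega)
    exact (h.measure_deviation_le hlam hK hδ0 hδ1 (by omega)
      (logTolerance_pos hlam hδ1 hθ (by omega)) h1).trans
      (ENNReal.ofReal_le_ofReal (h2.trans h3))
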